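/- Let $I=[0,1]$. For a topological space $X$ let $\mathcal G_X$ be the group of all self-homeomorphisms of $X$, and for a subgroup $G\le\mathcal G_X$ call a nonempty set $D\subseteq X$ invariant if $gD\subseteq D$ for all $g\in G$. The height of $(G,X)$ is $$h(G,X)=\sup\{n\ge 0:\text{ there are closed invariant } D_0,\dots,D_n\subseteq X\text{ with }\varnothing\ne D_0\subsetneq D_1\subsetneq\cdots\subsetneq D_n=X\}\in\mathbb N\cup\{+\infty\},$$ and $P_h(X)=\{h(G,X): G\text{ is a subgroup of }\mathcal G_X\}$ is the set of possible heights of $X$. Consider the following three topologies on the set $I\times I$: - $\mathbb A$ (the Alexandroff square): the topology generated by the sets $\{x\}\times U$, with $U$ open in $I$ and $x\in I\setminus U$, together with the sets $(I\times U)\setminus(F\times I)$, with $U$ open in $I$ and $F\subseteq I$ finite; - $\mathbb O$: the order topology of the lexicographic order, in which $(x,y)\le(s,t)$ if and only if $x<s$, or $x=s$ and $y\le t$; - $\mathbb U$: the topology induced from the Euclidean plane $\mathbb R^2$. **Theorem.** $h(\mathcal G_{\mathbb A},\mathbb A)=5$, $h(\mathcal G_{\mathbb O},\mathbb O)=4$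 and $h(\mathcal G_{\mathbb U},\mathbb U)=1$. Moreover, $\min P_h(\mathbb A)=5$, $\min P_h(\mathbb O)=4$ and $\min P_h(\mathbb U)=1$. -/

import Mathlib

open Set unitInterval

/-- A subset `D` of `X` is invariant under a group `G` of self-homeomorphisms of `X` if it is
nonempty and `G D ⊆ D`. -/
def IsInvariantUnder {X : Type*} [TopologicalSpace X] (G : Subgroup (X ≃ₜ X)) (D : Set X) : Prop :=
  D.Nonempty ∧ ∀ g ∈ G, ∀ y ∈ D, g y ∈ D

/-- There are closed invariant sets `∅ ≠ D₀ ⊊ D₁ ⊊ ⋯ ⊊ Dₙ = X`. -/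
def HasInvariantChain {X : Type*} [TopologicalSpace X] (G : Subgroup (X ≃ₜ X)) (n : ℕ) : Prop :=
  ∃ D : Fin (n + 1) → Set X,
    (∀ i, IsClosed (D i) ∧ IsInvariantUnder G (D i)) ∧
    (∀ i j, i < j → D i ⊂ D j) ∧
    D (Fin.last n) = univ

/-- The height `h(G, X)` of the transformation group `(G, X)`: the supremum, in `ℕ∞`, of the
lengths `n` of the chains of closed invariant sets. -/
noncomputable def groupHeight {X : Type*} [TopologicalSpace X] (G : Subgroup (X ≃ₜ X)) : ℕ∞ :=
  sSup {m : ℕ∞ | ∃ n : ℕ, m = (n : ℕ∞) ∧ HasInvariantChain G n}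

/-- The set `P_h(X)` of all possible heights of `X`. -/
def possibleHeights (X : Type*) [TopologicalSpace X] : Set ℕ∞ :=
  {m : ℕ∞ | ∃ G : Subgroup (X ≃ₜ X), m = groupHeight G}

/-- The set underlying the Alexandroff square `𝔸`: `[0,1] × [0,1]`. -/
def AlexandroffSquare : Type := I × I

/-- The basic open sets of the Alexandroff square: vertical pieces `{x} × U` with `x ∉ U`, and
horizontal strips `[0,1] × U` less finitely many vertical lines, for `U` open in `[0,1]`. -/
def alexandroffBasis : Set (Set (I × I)) :=
  {s | ∃ (x : I) (U : Set I), IsOpen U ∧ x ∉ U ∧ s = {x} ×ˢ U} ∪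
  {s | ∃ (U F : Set I), IsOpen U ∧ F.Finite ∧ s = (univ ×ˢ U) \ (F ×ˢ univ)}

instance : TopologicalSpace AlexandroffSquare :=
  TopologicalSpace.generateFrom alexandroffBasis

/-- The set underlying `𝕆`: `[0,1] × [0,1]`, ordered lexicographically. -/
def LexSquare : Type := I ×ₗ I

noncomputable instance : LinearOrder LexSquare := inferInstanceAs (LinearOrder (I ×ₗ I))

noncomputable instance : TopologicalSpace LexSquare := Preorder.topology LexSquare

/-- The space `𝕌`: `[0,1] × [0,1]` with the topology of the Euclidean plane, which is the
product topology. -/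
abbrev EuclideanSquare : Type := I × I

/-! A larger group has fewer invariant sets, so the least height is that of the full homeomorphism
group. Its invariant sets are unions of orbits. With `n + 1` orbits, a chain starting at a nonempty
set has length at most `n`, and this is attained if the orbits can be listed so that all initial
unions are closed (`groupHeight_top_eq`). It remains to find the orbits: 6 in 𝔸, 5 in 𝕆, 2 in 𝕌.

In 𝔸 and 𝕆 the topological invariant is local separability (`IsLocallySeparableAt`). It fails
exactly on the diagonal of 𝔸, and in 𝕆 exactly at the ends of columns other than the two ends of the
order. Away from these points each column is open, so a connected piece of a column is mapped into a
single column. Hence homeomorphisms permute the columns and preserve their ends; following the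
diagonal points, respectively the ends of the order, shows that they also preserve the outer
columns. Conversely, a homeomorphism of the interval acting on both coordinates of 𝔸, and products
of order automorphisms together with the reversal on 𝕆, join any two points of the same class.

In 𝕌 the boundary points are those whose complement carries a logarithm of every nonvanishing
function. Rotations of a disc homeomorphic to the square move boundary points to one another, and
products of interval homeomorphisms do so for interior points. -/

/-! ### Heights and orbits -/

theorem groupHeight_antitone {X : Type*} [TopologicalSpace X] :
    Antitone (groupHeight : Subgroup (X ≃ₜ X) → ℕ∞) := by
  intro G H hGH
  refine sSup_le_sSup ?_
  rintro _ ⟨n, rfl, D, hD, hlt, hlast⟩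
  exact ⟨n, rfl, D, fun i => ⟨(hD i).1, (hD i).2.1, fun g hg => (hD i).2.2 g (hGH hg)⟩, hlt, hlast⟩

theorem isLeast_possibleHeights_groupHeight_top (X : Type*) [TopologicalSpace X] :
    IsLeast (possibleHeights X) (groupHeight (⊤ : Subgroup (X ≃ₜ X))) := by
  refine ⟨⟨⊤, rfl⟩, ?_⟩
  rintro _ ⟨G, rfl⟩
  exact groupHeight_antitone le_top

/-- If the orbits of the homeomorphism group are the fibres of a map onto `{0, …, n}` whose
initial preimages are closed, then the height of the homeomorphism group is `n`. -/
theorem groupHeight_top_eq {X : Type*} [TopologicalSpace X] {n : ℕ} (c : X → Fin (n + 1))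
    (hsurj : Function.Surjective c) (hinv : ∀ (g : X ≃ₜ X) x, c (g x) = c x)
    (htrans : ∀ x y, c x = c y → ∃ g : X ≃ₜ X, g x = y)
    (hclosed : ∀ k, IsClosed {x | c x ≤ k}) :
    groupHeight (⊤ : Subgroup (X ≃ₜ X)) = n := by
  classical
  refine le_antisymm (sSup_le ?_) (le_sSup ⟨n, rfl, fun i => {x | c x ≤ i}, ?_, ?_, ?_⟩)
  · rintro _ ⟨m, rfl, D, hD, hlt, -⟩
    have hsat : ∀ i x y, c x = c y → x ∈ D i → y ∈ D i := by
      intro i x y hxy hx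
      obtain ⟨g, rfl⟩ := htrans x y hxy
      exact (hD i).2.2 g (Subgroup.mem_top g) x hx
    -- By `hsat` each `D i` is determined by the set of classes that it meets, so the chain becomes
    -- a strictly increasing chain of subsets of `Fin (n + 1)`.
    let F : Fin (m + 1) → Finset (Fin (n + 1)) := fun i => Finset.univ.filter (· ∈ c '' D i)
    have hmono : StrictMono F := by
      intro i j hij
      obtain ⟨hsub, hne⟩ := hlt i j hij
      obtain ⟨y, hy, hyi⟩ := not_subset.1 hne
      refine Finset.ssubset_iff_of_subset (fun a ha => ?_) |>.2 ⟨c y, ?_, ?_⟩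
      · simp only [F, Finset.mem_filter, Finset.mem_univ, true_and] at ha ⊢
        exact image_mono hsub ha
      · simpa [F] using ⟨y, hy, rfl⟩
      · simp only [F, Finset.mem_filter, Finset.mem_univ, true_and]
        rintro ⟨x, hx, hxy⟩
        exact hyi (hsat i x y hxy hx)
    -- The count starts at 1 because `D 0` is nonempty; this yields `m + 1 ≤ n + 1`.
    have hcard : ∀ k (hk : k < m + 1), k + 1 ≤ (F ⟨k, hk⟩).card := by
      intro k
      induction k with
      | zero =>
        intro hk
        obtain ⟨x, hx⟩ := (hD ⟨0, hk⟩).2.1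
        exact Finset.card_pos.2 ⟨c x, by simpa [F] using ⟨x, hx, rfl⟩⟩
      | succ k ih =>
        intro hk
        have h1 := ih (by omega)
        have h2 := Finset.card_lt_card (hmono (show (⟨k, by omega⟩ : Fin (m + 1)) < ⟨k + 1, hk⟩ by
          simp [Fin.lt_def]))
        omega
    have h1 := hcard m (by omega)
    have h2 := Finset.card_le_univ (F ⟨m, by omega⟩)
    rw [Fintype.card_fin] at h2
    exact_mod_cast (by omega : m ≤ n)
  · refine fun i => ⟨hclosed i, ?_, fun g _ y hy => ?_⟩
    · obtain ⟨x, hx⟩ := hsurj 0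
      exact ⟨x, by simp [hx]⟩
    · simpa [hinv] using hy
  · intro i j hij
    refine ⟨fun x hx => le_trans hx hij.le, fun h => ?_⟩
    obtain ⟨x, rfl⟩ := hsurj j
    exact absurd (h (le_refl (c x))) (not_le.2 hij)
  · exact eq_univ_of_forall fun x => Fin.le_last _

/-! ### Local separability -/

/-- A point with a neighbourhood that lies in the closure of a countable set. -/
def IsLocallySeparableAt {X : Type*} [TopologicalSpace X] (p : X) : Prop :=
  ∃ O : Set X, IsOpen O ∧ p ∈ O ∧ ∃ S : Set X, S.Countable ∧ O ⊆ closure S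

theorem IsLocallySeparableAt.map {X Y : Type*} [TopologicalSpace X] [TopologicalSpace Y] {p : X}
    (h : IsLocallySeparableAt p) (g : X ≃ₜ Y) : IsLocallySeparableAt (g p) := by
  obtain ⟨O, hO, hp, S, hS, hOS⟩ := h
  refine ⟨g '' O, g.isOpenMap O hO, mem_image_of_mem g hp, g '' S, hS.image g, ?_⟩
  rw [← g.image_closure]
  exact image_mono hOS

theorem isLocallySeparableAt_map_iff {X Y : Type*} [TopologicalSpace X] [TopologicalSpace Y]
    (g : X ≃ₜ Y) {p : X} : IsLocallySeparableAt (g p) ↔ IsLocallySeparableAt p :=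
  ⟨fun h => by simpa using h.map g.symm, fun h => h.map g⟩

/-! ### Endpoints and homeomorphisms of the interval -/

/-- The endpoints of the unit interval. -/
def IsEndpoint (t : I) : Prop := t = 0 ∨ t = 1

theorem isEndpoint_zero : IsEndpoint 0 := .inl rfl

theorem isEndpoint_one : IsEndpoint 1 := .inr rfl

theorem isClosed_setOf_isEndpoint : IsClosed {t : I | IsEndpoint t} :=
  (toFinite ({0, 1} : Set I)).isClosed

theorem not_isEndpoint_iff {t : I} : ¬ IsEndpoint t ↔ t ∈ Ioo (0 : I) 1 := by
  rw [IsEndpoint, not_or, mem_Ioo, unitInterval.pos_iff_ne_zero, unitInterval.lt_one_iff_ne_one]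

theorem exists_not_isEndpoint : ∃ t : I, ¬ IsEndpoint t := by
  obtain ⟨t, ht⟩ := exists_between (zero_lt_one (α := I))
  exact ⟨t, not_isEndpoint_iff.2 ht⟩

@[simp] theorem isEndpoint_symm {t : I} : IsEndpoint (σ t) ↔ IsEndpoint t := by
  rw [IsEndpoint, IsEndpoint, unitInterval.symm_eq_zero, unitInterval.symm_eq_one, or_comm]

/-- A continuous injection of the interval is strictly monotone or strictly antitone, so a bijective
one fixes the two endpoints or exchanges them. -/
theorem isEndpoint_apply_iff {f : I → I} (hf : Continuous f) (hb : Function.Bijective f) {t : I} :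
    IsEndpoint (f t) ↔ IsEndpoint t := by
  rcases hf.strictMono_of_inj hb.1 with h | h
  · let e := h.orderIsoOfSurjective f hb.2
    have h0 : f 0 = 0 := e.map_bot
    have h1 : f 1 = 1 := e.map_top
    have e0 : f t = 0 ↔ t = 0 := by rw [← hb.1.eq_iff (a := t), h0]
    have e1 : f t = 1 ↔ t = 1 := by rw [← hb.1.eq_iff (a := t), h1]
    rw [IsEndpoint, IsEndpoint, e0, e1]
  · have h0 : f 0 = 1 := by
      obtain ⟨s, hs⟩ := hb.2 1
      exact le_antisymm le_one' (hs ▸ h.antitone nonneg')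
    have h1 : f 1 = 0 := by
      obtain ⟨s, hs⟩ := hb.2 0
      exact le_antisymm (hs ▸ h.antitone le_one') nonneg'
    have e0 : f t = 1 ↔ t = 0 := by rw [← hb.1.eq_iff (a := t), h0]
    have e1 : f t = 0 ↔ t = 1 := by rw [← hb.1.eq_iff (a := t), h1]
    rw [IsEndpoint, IsEndpoint, e0, e1, or_comm]

/-- Multiplying the odds `x / (1 - x)` by a constant, after raising them to a power. -/
theorem exists_orderIso_odds {c p : ℝ} (hc : 0 < c) (hp : 0 < p) :
    ∃ f : I ≃o I, ∀ x : I, (f x : ℝ) =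
      (x : ℝ) ^ p / ((x : ℝ) ^ p + c * (1 - x : ℝ) ^ p) := by
  have hden : ∀ x : I, 0 < (x : ℝ) ^ p + c * (1 - x : ℝ) ^ p := by
    intro x
    rcases eq_or_lt_of_le x.2.1 with h | h
    · rw [← h]; simp [Real.zero_rpow hp.ne', hc]
    · have := Real.rpow_pos_of_pos h p
      have := Real.rpow_nonneg (sub_nonneg.2 x.2.2) p
      positivity
  have hnum : ∀ x : I, 0 ≤ (x : ℝ) ^ p := fun x => Real.rpow_nonneg x.2.1 p
  have hnum' : ∀ x : I, 0 ≤ (1 - x : ℝ) ^ p := fun x => Real.rpow_nonneg (sub_nonneg.2 x.2.2) p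
  let f : I → I := fun x => ⟨(x : ℝ) ^ p / ((x : ℝ) ^ p + c * (1 - x : ℝ) ^ p),
    div_nonneg (hnum x) (hden x).le, (div_le_one (hden x)).2 (by nlinarith [hnum' x])⟩
  have hmono : StrictMono f := by
    intro x y hxy
    have hxy' : (x : ℝ) < y := hxy
    have h1 := Real.rpow_lt_rpow x.2.1 hxy' hp
    have h2 := Real.rpow_lt_rpow (sub_nonneg.2 y.2.2) (sub_lt_sub_left hxy' 1) hp
    change (_ : ℝ) / _ < _ / _
    rw [div_lt_div_iff₀ (hden x) (hden y)]
    have h3 := mul_lt_mul'' h1 h2 (hnum x) (hnum' y)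
    nlinarith
  have hcont : Continuous f := by
    refine Continuous.subtype_mk (Continuous.div ?_ ?_ fun x => (hden x).ne') _
    · exact continuous_subtype_val.rpow_const fun _ => .inr hp.le
    · exact (continuous_subtype_val.rpow_const fun _ => .inr hp.le).add
        (continuous_const.mul ((continuous_const.sub continuous_subtype_val).rpow_const
          fun _ => .inr hp.le))
  have h0 : f 0 = 0 := Subtype.ext (by simp [f, Real.zero_rpow hp.ne'])
  have h1 : f 1 = 1 := Subtype.ext (by simp [f, Real.zero_rpow hp.ne'])
  have hsurj : Function.Surjective f := by
    intro y
    obtain ⟨x, -, hx⟩ := intermediate_value_Icc (zero_le_one (α := I)) hcont.continuousOn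
      (show y ∈ Icc (f 0) (f 1) by rw [h0, h1]; exact ⟨nonneg', le_one'⟩)
    exact ⟨x, hx⟩
  exact ⟨hmono.orderIsoOfSurjective f hsurj, fun x => rfl⟩

/-- In the coordinate `(1 - x) / x` the maps of `exists_orderIso_odds` are `t ↦ c * t ^ p`. Two
parameters meet two conditions: the ratio of the coordinates of the two points determines `p`, and
then the first point determines `c`. The exponent is positive because both pairs are in the same
order. -/
theorem exists_orderIso_apply_eq_apply_eq {a b a' b' : I} (ha : 0 < a) (hab : a < b) (hb : b < 1)
    (ha' : 0 < a') (hab' : a' < b') (hb' : b' < 1) : ∃ f : I ≃o I, f a = a' ∧ f b = b' := by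
  obtain ⟨a, ha0, ha1⟩ := a
  obtain ⟨b, hb0, hb1⟩ := b
  obtain ⟨a', ha0', ha1'⟩ := a'
  obtain ⟨b', hb0', hb1'⟩ := b'
  replace ha : 0 < a := ha
  replace hab : a < b := hab
  replace hb : b < 1 := hb
  replace ha' : 0 < a' := ha'
  replace hab' : a' < b' := hab'
  replace hb' : b' < 1 := hb'
  have key : ∀ x y : ℝ, 0 < x → x < y → y < 1 → 0 < (1 - y) / y ∧ (1 - y) / y < (1 - x) / x := by
    intro x y hx hxy hy
    have hy0 : 0 < y := hx.trans hxy
    refine ⟨div_pos (by linarith) hy0, ?_⟩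
    rw [div_lt_div_iff₀ hy0 hx]
    nlinarith
  obtain ⟨hs, hsr⟩ := key a b ha hab hb
  obtain ⟨hs', hsr'⟩ := key a' b' ha' hab' hb'
  set r := (1 - a) / a with hr
  set s := (1 - b) / b with hsdef
  set r' := (1 - a') / a' with hr'
  set s' := (1 - b') / b' with hsdef'
  have hr0 : 0 < r := hs.trans hsr
  have hr0' : 0 < r' := hs'.trans hsr'
  have hlog : 0 < Real.log (r / s) := Real.log_pos ((one_lt_div hs).2 hsr)
  have hlog' : 0 < Real.log (r' / s') := Real.log_pos ((one_lt_div hs').2 hsr')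
  set p := Real.log (r' / s') / Real.log (r / s) with hpdef
  have hp : 0 < p := div_pos hlog' hlog
  have hrp : 0 < r ^ p := Real.rpow_pos_of_pos hr0 p
  obtain ⟨f, hf⟩ := exists_orderIso_odds (c := r' / r ^ p) (p := p) (div_pos hr0' hrp) hp
  have hpow : (r / s) ^ p = r' / s' := by
    rw [Real.rpow_def_of_pos (div_pos hr0 hs), hpdef, mul_div_cancel₀ _ hlog.ne',
      Real.exp_log (div_pos hr0' hs')]
  have hval : ∀ x y t : ℝ, 0 < x → x < 1 → 0 < y → t = (1 - x) / x →
      r' / r ^ p * t ^ p = (1 - y) / y →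
      x ^ p / (x ^ p + r' / r ^ p * (1 - x) ^ p) = y := by
    intro x y t hx hx1 hy ht h
    have hxp : 0 < x ^ p := Real.rpow_pos_of_pos hx p
    have h1 : (1 - x) ^ p = t ^ p * x ^ p := by
      rw [ht, Real.div_rpow (by linarith) hx.le, div_mul_cancel₀ _ hxp.ne']
    rw [h1, ← mul_assoc, h]
    field_simp
    ring
  refine ⟨f, Subtype.ext ?_, Subtype.ext ?_⟩
  · rw [hf]
    refine hval a a' r ha (hab.trans hb) ha' hr ?_
    rw [div_mul_cancel₀ _ hrp.ne']
  · rw [hf]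
    refine hval b b' s (ha.trans hab) hb (ha'.trans hab') hsdef ?_
    rw [Real.div_rpow hr0.le hs.le] at hpow
    have hsp : 0 < s ^ p := Real.rpow_pos_of_pos hs p
    rw [← hsdef']
    field_simp at hpow ⊢
    linarith

theorem exists_orderIso_apply_eq {a b : I} (h0 : a = 0 ↔ b = 0) (h1 : a = 1 ↔ b = 1) :
    ∃ f : I ≃o I, f a = b := by
  by_cases ha0 : a = 0
  · exact ⟨OrderIso.refl I, by rw [h0.1 ha0, ha0]; rfl⟩
  by_cases ha1 : a = 1
  · exact ⟨OrderIso.refl I, by rw [h1.1 ha1, ha1]; rfl⟩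
  have ha : a < 1 := unitInterval.lt_one_iff_ne_one.2 ha1
  have hb : b < 1 := unitInterval.lt_one_iff_ne_one.2 (mt h1.2 ha1)
  obtain ⟨c, hac, hc⟩ := exists_between ha
  obtain ⟨d, hbd, hd⟩ := exists_between hb
  obtain ⟨f, hf, -⟩ := exists_orderIso_apply_eq_apply_eq (unitInterval.pos_iff_ne_zero.2 ha0) hac hc
    (unitInterval.pos_iff_ne_zero.2 (mt h0.2 ha0)) hbd hd
  exact ⟨f, hf⟩

theorem exists_homeomorph_apply_eq {a b : I} (h : IsEndpoint a ↔ IsEndpoint b) :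
    ∃ f : I ≃ₜ I, f a = b := by
  by_cases ha : a = 0 ∧ b = 1 ∨ a = 1 ∧ b = 0
  · refine ⟨unitInterval.symmHomeomorph, ?_⟩
    rcases ha with ⟨rfl, rfl⟩ | ⟨rfl, rfl⟩ <;> simp
  · obtain ⟨f, hf⟩ := exists_orderIso_apply_eq (a := a) (b := b)
      (by unfold IsEndpoint at h; have := zero_ne_one (α := I); grind)
      (by unfold IsEndpoint at h; have := zero_ne_one (α := I); grind)
    exact ⟨f.toHomeomorph, hf⟩

/-- Exchanging the points and reflecting the target reduce to `x < y` and `x' < y'`. Then the only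
possible endpoints are 0 for the lower point and 1 for the upper one; order automorphisms fix these,
so at most two interior points have to be moved. -/
theorem exists_homeomorph_apply_eq_apply_eq {x y x' y' : I} (h : x = y ↔ x' = y')
    (hx : IsEndpoint x ↔ IsEndpoint x') (hy : IsEndpoint y ↔ IsEndpoint y') :
    ∃ f : I ≃ₜ I, f x = x' ∧ f y = y' := by
  wlog hxy : x ≤ y generalizing x y x' y'
  · obtain ⟨f, h1, h2⟩ := this (by rw [eq_comm, h, eq_comm]) hy hx (le_of_not_ge hxy)
    exact ⟨f, h2, h1⟩
  rcases hxy.eq_or_lt with rfl | hxy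
  · obtain ⟨f, hf⟩ := exists_homeomorph_apply_eq hx
    exact ⟨f, hf, by rw [hf]; exact h.1 rfl⟩
  wlog hxy' : x' < y' generalizing x' y'
  · have hne : x' ≠ y' := fun h' => hxy.ne (h.2 h')
    obtain ⟨f, h1, h2⟩ := this (x' := σ x') (y' := σ y')
      (by rw [unitInterval.symm_inj]; exact h) (by rwa [isEndpoint_symm])
      (by rwa [isEndpoint_symm])
      (unitInterval.symm_lt_symm.2 (lt_of_le_of_ne (not_lt.1 hxy') hne.symm))
    exact ⟨f.trans unitInterval.symmHomeomorph, by simp [h1], by simp [h2]⟩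
  have e : ∀ {a b : I}, a < b → (IsEndpoint a ↔ a = 0) ∧ (IsEndpoint b ↔ b = 1) := by
    intro a b hab
    have h1 : a ≠ 1 := (hab.trans_le le_one').ne
    have h2 : b ≠ 0 := (nonneg'.trans_lt hab).ne'
    exact ⟨by simp [IsEndpoint, h1], by simp [IsEndpoint, h2]⟩
  rw [(e hxy).1, (e hxy').1] at hx
  rw [(e hxy).2, (e hxy').2] at hy
  have n1 : ∀ {a b : I}, a < b → a ≠ 1 := fun hab => (hab.trans_le le_one').ne
  have n0 : ∀ {a b : I}, a < b → b ≠ 0 := fun hab => (nonneg'.trans_lt hab).ne'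
  by_cases hx0 : x = 0
  · obtain ⟨f, hf⟩ := exists_orderIso_apply_eq (a := y) (b := y') (by simp [n0 hxy, n0 hxy']) hy
    exact ⟨f.toHomeomorph, by rw [hx.1 hx0, hx0]; exact f.map_bot, hf⟩
  by_cases hy1 : y = 1
  · obtain ⟨f, hf⟩ := exists_orderIso_apply_eq (a := x) (b := x') hx (by simp [n1 hxy, n1 hxy'])
    exact ⟨f.toHomeomorph, hf, by rw [hy.1 hy1, hy1]; exact f.map_top⟩
  obtain ⟨f, h1, h2⟩ := exists_orderIso_apply_eq_apply_eq (unitInterval.pos_iff_ne_zero.2 hx0) hxy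
    (unitInterval.lt_one_iff_ne_one.2 hy1) (unitInterval.pos_iff_ne_zero.2 (mt hx.2 hx0)) hxy'
    (unitInterval.lt_one_iff_ne_one.2 (mt hy.2 hy1))
  exact ⟨f.toHomeomorph, h1, h2⟩

theorem not_countable_Ioo_unitInterval {a b : I} (h : a < b) : ¬ (Ioo a b).Countable := by
  intro hc
  have h1 : (Ioo (a : ℝ) b).Countable := by
    refine (hc.image Subtype.val).mono fun t ht => ?_
    exact ⟨⟨t, a.2.1.trans ht.1.le, ht.2.le.trans b.2.2⟩, ht, rfl⟩
  exact absurd (Cardinal.Real.Ioo_countable_iff.1 h1) (not_le.2 h)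

/-! ### Columns of a square with general topology -/

section Columns

variable {X : Type*} [TopologicalSpace X] (p : X ≃ I × I)

/-- The column carries the image of a countable dense subset of the interval. -/
theorem isLocallySeparableAt_of_column {U : Set X} {x : I} (hU : IsOpen {q | q ∈ U ∧ (p q).1 = x})
    (hcol : Continuous fun y => p.symm (x, y)) {q : X} (hq : q ∈ U) (hqx : (p q).1 = x) :
    IsLocallySeparableAt q := by
  obtain ⟨D, hD, hdense⟩ := TopologicalSpace.exists_countable_dense I
  refine ⟨_, hU, ⟨hq, hqx⟩, _, hD.image fun y => p.symm (x, y), ?_⟩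
  rintro r ⟨-, hr⟩
  have h1 := image_closure_subset_closure_image hcol (mem_image_of_mem _ (hdense (p r).2))
  have h2 : p.symm (x, (p r).2) = r := by rw [← hr]; exact p.symm_apply_apply r
  rwa [h2] at h1

/-- An open set that has open columns over an uncountable set of abscissas is not contained in
the closure of a countable set. -/
theorem not_subset_closure_of_uncountable_columns {O S : Set X} {A : Set I} (hA : ¬ A.Countable)
    (hS : S.Countable)
    (h : ∀ x ∈ A, ∃ V : Set X, IsOpen V ∧ V.Nonempty ∧ V ⊆ O ∧ ∀ q ∈ V, (p q).1 = x) :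
    ¬ O ⊆ closure S := by
  intro hO
  -- Each `V` would meet `S`, so the abscissas of the countable set `S` would exhaust `A`.
  refine hA ((hS.image fun q => (p q).1).mono fun x hx => ?_)
  obtain ⟨V, hV, ⟨q, hq⟩, hVO, hVx⟩ := h x hx
  obtain ⟨r, hrV, hrS⟩ := mem_closure_iff.1 (hO (hVO hq)) V hV hq
  exact ⟨r, hrS, hVx r hrV⟩

/-- A connected set of parameters is mapped to a single column, provided that it avoids the
points where the columns are not open. -/
theorem exists_column_of_isPreconnected {U : Set X}
    (hU : ∀ x, IsOpen {q | q ∈ U ∧ (p q).1 = x}) (hclosed : ∀ x, IsClosed {q | (p q).1 = x})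
    {T : Set I} (hT : IsPreconnected T) (hne : T.Nonempty) {f : I → X} (hf : Continuous f)
    (hfT : MapsTo f T U) : ∃ c, ∀ y ∈ closure T, (p (f y)).1 = c := by
  obtain ⟨y₀, hy₀⟩ := hne
  refine ⟨(p (f y₀)).1, ?_⟩
  set c := (p (f y₀)).1 with hc
  -- The connected image is covered by two disjoint open sets, the part of `U` in column `c` and the
  -- part in the other columns; it meets the first.
  have h1 : f '' T ⊆ {q | q ∈ U ∧ (p q).1 = c} := by
    refine (hT.image f hf.continuousOn).subset_left_of_subset_union (hU c)
      (isOpen_iUnion fun x : {x // x ≠ c} => hU x) ?_ ?_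
      ⟨f y₀, mem_image_of_mem f hy₀, hfT hy₀, rfl⟩
    · rw [disjoint_left]
      rintro q ⟨-, hq⟩ hq'
      obtain ⟨⟨x, hx⟩, -, hqx⟩ := mem_iUnion.1 hq'
      exact hx (hqx.symm.trans hq)
    · rintro _ ⟨y, hy, rfl⟩
      by_cases h : (p (f y)).1 = c
      · exact .inl ⟨hfT hy, h⟩
      · exact .inr (mem_iUnion.2 ⟨⟨_, h⟩, hfT hy, rfl⟩)
  exact fun y hy => closure_minimal (fun y hy => (h1 (mem_image_of_mem f hy)).2)
    ((hclosed c).preimage hf) hy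

/-- If the homeomorphisms permute the columns, they preserve the set of endpoints of columns. -/
theorem isEndpoint_snd_homeomorph_iff
    (hemb : ∀ x, Topology.IsEmbedding fun y => p.symm (x, y))
    (hperm : ∀ (g : X ≃ₜ X) (x : I), ∃ c, ∀ y, (p (g (p.symm (x, y)))).1 = c)
    (g : X ≃ₜ X) (q : X) : IsEndpoint (p (g q)).2 ↔ IsEndpoint (p q).2 := by
  obtain ⟨⟨x, y⟩, rfl⟩ := p.symm.surjective q
  obtain ⟨c, hc⟩ := hperm g x
  obtain ⟨x', hx'⟩ := hperm g.symm c
  have hg : ∀ t, p.symm (c, (p (g (p.symm (x, t)))).2) = g (p.symm (x, t)) := by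
    intro t
    rw [← hc t]
    exact p.symm_apply_apply _
  -- The inverse maps column `c` into one column, which contains a point of column `x`. So `g`
  -- restricts to a bijection between the columns `x` and `c`.
  have hxx : x' = x := by
    rw [← hx' (p (g (p.symm (x, y)))).2, hg]
    simp
  have h := isEndpoint_apply_iff (f := fun t => (p (g (p.symm (x, t)))).2) ?_ ⟨?_, ?_⟩ (t := y)
  · simpa using h
  · rw [(hemb c).continuous_iff]
    have h1 : (fun y => p.symm (c, y)) ∘ (fun t => (p (g (p.symm (x, t)))).2) =
        fun t => g (p.symm (x, t)) := funext hg
    rw [h1]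
    exact g.continuous.comp (hemb x).continuous
  · intro s t hst
    have h1 : g (p.symm (x, s)) = g (p.symm (x, t)) := by
      rw [← hg s, ← hg t]
      simp only at hst
      rw [hst]
    simpa using h1
  · intro t
    refine ⟨(p (g.symm (p.symm (c, t)))).2, ?_⟩
    have h1 : (x, (p (g.symm (p.symm (c, t)))).2) = p (g.symm (p.symm (c, t))) :=
      Prod.ext (by rw [hx' t, hxx]) rfl
    simp [h1]

end Columns

/-! ### The Alexandroff square -/

/-- The coordinates on the Alexandroff square. -/
def alexandroffEquiv : AlexandroffSquare ≃ I × I := Equiv.refl _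

namespace AlexandroffSquare

local notation "π" => alexandroffEquiv

theorem isOpen_vertical {x : I} {U : Set I} (hU : IsOpen U) (hx : x ∉ U) :
    IsOpen (π ⁻¹' ({x} ×ˢ U)) :=
  TopologicalSpace.isOpen_generateFrom_of_mem (.inl ⟨x, U, hU, hx, rfl⟩)

theorem isOpen_strip {U F : Set I} (hU : IsOpen U) (hF : F.Finite) :
    IsOpen (π ⁻¹' ((univ ×ˢ U) \ (F ×ˢ univ))) :=
  TopologicalSpace.isOpen_generateFrom_of_mem (.inr ⟨U, F, hU, hF, rfl⟩)

theorem continuous_of_basis {Y : Type*} [TopologicalSpace Y] {f : Y → AlexandroffSquare}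
    (h1 : ∀ (x : I) (U : Set I), IsOpen U → x ∉ U → IsOpen {y | (π (f y)).1 = x ∧ (π (f y)).2 ∈ U})
    (h2 : ∀ U F : Set I, IsOpen U → F.Finite → IsOpen {y | (π (f y)).2 ∈ U ∧ (π (f y)).1 ∉ F}) :
    Continuous f := by
  refine continuous_generateFrom_iff.2 ?_
  rintro s (⟨x, U, hU, hx, rfl⟩ | ⟨U, F, hU, hF, rfl⟩)
  · convert h1 x U hU hx using 1
    ext y
    exact Iff.rfl
  · convert h2 U F hU hF using 1
    ext y
    exact ⟨fun h => ⟨h.1.2, fun hF => h.2 ⟨hF, trivial⟩⟩,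
      fun h => ⟨⟨trivial, h.1⟩, fun hF => h.2 hF.1⟩⟩

theorem continuous_snd : Continuous fun q => (π q).2 := by
  refine continuous_def.2 fun U hU => ?_
  convert isOpen_strip hU finite_empty using 1
  ext q
  simp

theorem isClosed_column (x : I) : IsClosed {q | (π q).1 = x} := by
  rw [← isOpen_compl_iff]
  convert isOpen_strip isOpen_univ (finite_singleton x) using 1
  ext q
  simp

theorem continuous_column (x : I) : Continuous fun y => (π).symm (x, y) := by
  refine continuous_of_basis (fun x' U hU _ => ?_) fun U F hU _ => ?_
  · by_cases h : x = x'
    · simpa [h] using hU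
    · simp [h]
  · by_cases h : x ∈ F
    · simp [h]
    · simpa [h] using hU

theorem isEmbedding_column (x : I) : Topology.IsEmbedding fun y => (π).symm (x, y) := by
  refine .of_leftInverse (f := fun q => (π q).2) (fun y => ?_) continuous_snd (continuous_column x)
  simp

/-- A set that misses the diagonal and has open sections is a union of vertical basic sets. -/
theorem isOpen_of_columns {s : Set AlexandroffSquare} (h0 : ∀ x, (π).symm (x, x) ∉ s)
    (h : ∀ x, IsOpen {y | (π).symm (x, y) ∈ s}) : IsOpen s := by
  have h1 : s = ⋃ x, π ⁻¹' ({x} ×ˢ {y | (π).symm (x, y) ∈ s}) := by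
    ext q
    simp only [mem_iUnion, mem_preimage, mem_prod, mem_singleton_iff, mem_ofPred_eq]
    constructor
    · intro hq
      exact ⟨(π q).1, rfl, by simpa using hq⟩
    · rintro ⟨x, rfl, hq⟩
      simpa using hq
  rw [h1]
  exact isOpen_iUnion fun x => isOpen_vertical (h x) (h0 x)

theorem isClosed_of_columns {s : Set AlexandroffSquare} (h0 : ∀ x, (π).symm (x, x) ∈ s)
    (h : ∀ x, IsClosed {y | (π).symm (x, y) ∈ s}) : IsClosed s :=
  isOpen_compl_iff.1 <| isOpen_of_columns (fun x hx => hx (h0 x)) fun x => (h x).isOpen_compl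

/-- A vertical basic set never contains a diagonal point, so only the strips matter there, and
strips are stable under finite intersection. -/
theorem exists_strip_subset {O : Set AlexandroffSquare} (hO : IsOpen O) {t : I}
    (ht : (π).symm (t, t) ∈ O) :
    ∃ U F : Set I, IsOpen U ∧ t ∈ U ∧ F.Finite ∧ π ⁻¹' ((univ ×ˢ U) \ (F ×ˢ univ)) ⊆ O := by
  induction hO with
  | basic s hs =>
    rcases hs with ⟨x, U, hU, hx, rfl⟩ | ⟨U, F, hU, hF, rfl⟩
    · obtain ⟨h1, h2⟩ := ht
      exact absurd h2 (by rwa [show t = x from h1])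
    · exact ⟨U, F, hU, ht.1.2, hF, Subset.rfl⟩
  | univ => exact ⟨univ, ∅, isOpen_univ, mem_univ t, finite_empty, subset_univ _⟩
  | inter s s' _ _ ih ih' =>
    obtain ⟨U, F, hU, htU, hF, h⟩ := ih ht.1
    obtain ⟨U', F', hU', htU', hF', h'⟩ := ih' ht.2
    refine ⟨U ∩ U', F ∪ F', hU.inter hU', ⟨htU, htU'⟩, hF.union hF', fun q hq => ⟨h ?_, h' ?_⟩⟩
    · simp only [mem_preimage, mem_sdiff, mem_prod, mem_univ, true_and, and_true, mem_inter_iff,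
        mem_union, not_or] at hq ⊢
      exact ⟨hq.1.1, hq.2.1⟩
    · simp only [mem_preimage, mem_sdiff, mem_prod, mem_univ, true_and, and_true, mem_inter_iff,
        mem_union, not_or] at hq ⊢
      exact ⟨hq.1.2, hq.2.2⟩
  | sUnion S _ ih =>
    obtain ⟨s, hs, hts⟩ := ht
    obtain ⟨U, F, hU, htU, hF, h⟩ := ih s hs hts
    exact ⟨U, F, hU, htU, hF, h.trans (subset_sUnion_of_mem hs)⟩

theorem isOpen_column_sdiff_diagonal (x : I) :
    IsOpen {q | q ∈ {q | (π q).1 ≠ (π q).2} ∧ (π q).1 = x} := by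
  convert isOpen_vertical (x := x) (U := {x}ᶜ) isOpen_compl_singleton (by simp) using 1
  ext q
  simp only [mem_ofPred_eq, mem_preimage, mem_prod, mem_singleton_iff, mem_compl_iff]
  grind

/-- A neighbourhood of a diagonal point contains a strip, which contains nonempty open pieces of all
but finitely many columns. Off the diagonal, the column without its diagonal point is an open
separable set. -/
theorem isLocallySeparableAt_iff {q : AlexandroffSquare} :
    IsLocallySeparableAt q ↔ (π q).1 ≠ (π q).2 := by
  constructor
  · rintro ⟨O, hO, hq, S, hS, hOS⟩ h
    have hqt : (π).symm ((π q).1, (π q).1) = q := by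
      apply (π).injective
      rw [Equiv.apply_symm_apply]
      exact Prod.ext rfl h
    obtain ⟨U, F, hU, htU, hF, hUF⟩ := exists_strip_subset hO (t := (π q).1) (by rwa [hqt])
    refine not_subset_closure_of_uncountable_columns π (A := Fᶜ) ?_ hS ?_ hOS
    · intro hc
      refine not_countable_Ioo_unitInterval (zero_lt_one (α := I)) ((hF.countable.union hc).mono ?_)
      rw [union_compl_self]
      exact subset_univ _
    · intro x hx
      refine ⟨π ⁻¹' ({x} ×ˢ (U \ {x})), isOpen_vertical (hU.sdiff isClosed_singleton) (by simp),
        ?_, ?_, fun r hr => hr.1⟩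
      · obtain ⟨y, hy, hyx⟩ := (infinite_of_mem_nhds _ (hU.mem_nhds htU)).exists_notMem_finset {x}
        exact ⟨(π).symm (x, y), by simpa using ⟨hy, by simpa using hyx⟩⟩
      · rintro r ⟨h1, h2⟩
        refine hUF ⟨⟨trivial, h2.1⟩, fun h => hx ?_⟩
        rw [← show (π r).1 = x from h1]
        exact h.1
  · exact fun h => isLocallySeparableAt_of_column π (isOpen_column_sdiff_diagonal _)
      (continuous_column _) h rfl

theorem diagonal_homeomorph_iff (g : AlexandroffSquare ≃ₜ AlexandroffSquare)
    (q : AlexandroffSquare) : (π (g q)).1 = (π (g q)).2 ↔ (π q).1 = (π q).2 := by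
  rw [← not_iff_not, ← ne_eq, ← ne_eq, ← isLocallySeparableAt_iff, ← isLocallySeparableAt_iff,
    isLocallySeparableAt_map_iff]

/-- The diagonal point cuts its column into at most two intervals. Each is mapped off the diagonal,
hence into one column, and has the diagonal point in its closure, so both go to the column of the
image of that point. -/
theorem fst_homeomorph_column (g : AlexandroffSquare ≃ₜ AlexandroffSquare) (x y : I) :
    (π (g ((π).symm (x, y)))).1 = (π (g ((π).symm (x, x)))).1 := by
  have key : ∀ T : Set I, IsPreconnected T → T.Nonempty → x ∉ T → x ∈ closure T →
      ∀ y ∈ T, (π (g ((π).symm (x, y)))).1 = (π (g ((π).symm (x, x)))).1 := by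
    intro T hT hne hxT hxT' y hy
    obtain ⟨c, hc⟩ := exists_column_of_isPreconnected π isOpen_column_sdiff_diagonal
      isClosed_column hT hne (f := fun y => g ((π).symm (x, y)))
      (g.continuous.comp (continuous_column x)) (by
        intro y hy
        rw [mem_ofPred_eq, ne_eq, diagonal_homeomorph_iff]
        simp only [Equiv.apply_symm_apply]
        rintro rfl
        exact hxT hy)
    rw [hc y (subset_closure hy), hc x hxT']
  rcases lt_trichotomy x y with h | rfl | h
  · exact key (Ioc x y) isPreconnected_Ioc ⟨y, h, le_rfl⟩ (by simp)
      (by rw [closure_Ioc h.ne]; exact ⟨le_rfl, h.le⟩) y ⟨h, le_rfl⟩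
  · rfl
  · exact key (Ico y x) isPreconnected_Ico ⟨y, le_rfl, h⟩ (by simp)
      (by rw [closure_Ico h.ne]; exact ⟨h.le, le_rfl⟩) y ⟨le_rfl, h⟩

theorem isEndpoint_snd_iff (g : AlexandroffSquare ≃ₜ AlexandroffSquare) (q : AlexandroffSquare) :
    IsEndpoint (π (g q)).2 ↔ IsEndpoint (π q).2 :=
  isEndpoint_snd_homeomorph_iff π isEmbedding_column
    (fun g x => ⟨_, fst_homeomorph_column g x⟩) g q

/-- The diagonal point of a column goes to the diagonal point of the image column, and for diagonal
points the two coordinates agree, so the invariance of the second coordinate suffices. -/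
theorem isEndpoint_fst_iff (g : AlexandroffSquare ≃ₜ AlexandroffSquare) (q : AlexandroffSquare) :
    IsEndpoint (π (g q)).1 ↔ IsEndpoint (π q).1 := by
  obtain ⟨⟨x, y⟩, rfl⟩ := (π).symm.surjective q
  have h1 := isEndpoint_snd_iff g ((π).symm (x, x))
  rw [fst_homeomorph_column, (diagonal_homeomorph_iff g _).2 (by simp), h1]
  simp

/-- The action of a homeomorphism of the interval on both coordinates. -/
theorem exists_homeomorph_map (f : I ≃ₜ I) : ∃ g : AlexandroffSquare ≃ₜ AlexandroffSquare,
    ∀ q, π (g q) = (f (π q).1, f (π q).2) := by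
  have hcont : ∀ f : I ≃ₜ I, Continuous fun q => (π).symm (f (π q).1, f (π q).2) := by
    intro f
    refine continuous_of_basis (fun x U hU hx => ?_) fun U F hU hF => ?_
    · convert isOpen_vertical (x := f.symm x) (hU.preimage f.continuous) (by simpa using hx) using 1
      ext q
      simp [← f.eq_symm_apply]
    · convert isOpen_strip (hU.preimage f.continuous) (hF.preimage f.injective.injOn) using 1
      ext q
      simp
  exact ⟨⟨⟨_, fun q => (π).symm (f.symm (π q).1, f.symm (π q).2), fun q => by simp,
    fun q => by simp⟩, hcont f, hcont f.symm⟩, fun q => rfl⟩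

open Classical in
/-- The number of the orbit of a point: the corners and the other points of the diagonal, the
other endpoints of the outer columns and the rest of these columns, the endpoints of the inner
columns, and the rest. -/
noncomputable def orbitClass (q : AlexandroffSquare) : Fin 6 :=
  if (π q).1 = (π q).2 then if IsEndpoint (π q).1 then 0 else 1
  else if IsEndpoint (π q).1 then if IsEndpoint (π q).2 then 2 else 3
  else if IsEndpoint (π q).2 then 4 else 5

theorem orbitClass_homeomorph (g : AlexandroffSquare ≃ₜ AlexandroffSquare)
    (q : AlexandroffSquare) : orbitClass (g q) = orbitClass q := by
  unfold orbitClass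
  simp only [diagonal_homeomorph_iff]
  rw [isEndpoint_fst_iff, isEndpoint_snd_iff]

theorem exists_homeomorph_of_orbitClass_eq {q r : AlexandroffSquare}
    (h : orbitClass q = orbitClass r) : ∃ g : AlexandroffSquare ≃ₜ AlexandroffSquare, g q = r := by
  obtain ⟨f, h1, h2⟩ := exists_homeomorph_apply_eq_apply_eq (x := (π q).1) (y := (π q).2)
    (x' := (π r).1) (y' := (π r).2)
    (by unfold orbitClass at h; split_ifs at h <;> simp_all)
    (by unfold orbitClass at h; split_ifs at h <;> simp_all)
    (by unfold orbitClass at h; split_ifs at h <;> simp_all)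
  obtain ⟨g, hg⟩ := exists_homeomorph_map f
  refine ⟨g, (π).injective ?_⟩
  rw [hg, h1, h2]

theorem orbitClass_surjective : Function.Surjective orbitClass := by
  obtain ⟨t, ht⟩ := exists_not_isEndpoint
  obtain ⟨s, h0, hs⟩ := exists_between (not_isEndpoint_iff.1 ht).1
  have hs' : ¬ IsEndpoint s := not_isEndpoint_iff.2 ⟨h0, hs.trans (not_isEndpoint_iff.1 ht).2⟩
  have h0t : (0 : I) ≠ t := (h0.trans hs).ne
  have ht0 : t ≠ 0 := h0t.symm
  have e0 := isEndpoint_zero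
  have e1 := isEndpoint_one
  have h : ∀ x y, orbitClass ((π).symm (x, y)) = _ := fun x y => by
    unfold orbitClass
    rw [Equiv.apply_symm_apply]
  intro k
  fin_cases k
  · exact ⟨(π).symm (0, 0), by simp [h, e0]⟩
  · exact ⟨(π).symm (t, t), by simp [h, ht]⟩
  · exact ⟨(π).symm (0, 1), by simp [h, e0, e1]⟩
  · exact ⟨(π).symm (0, t), by simp [h, e0, ht, h0t]⟩
  · exact ⟨(π).symm (t, 0), by simp [h, e0, ht, ht0]⟩
  · exact ⟨(π).symm (s, t), by simp [h, ht, hs', hs.ne]⟩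

/-- From class 1 on, the initial unions contain the whole diagonal, so closedness can be tested on
each column separately. The union for `k = 0`, the two diagonal corners, needs its own argument. -/
theorem isClosed_orbitClass_le_of_iff {k : Fin 6} {P Q : I → Prop}
    (h : ∀ x y, orbitClass ((π).symm (x, y)) ≤ k ↔ x = y ∨ P x ∧ IsEndpoint y ∨ Q x) :
    IsClosed {q | orbitClass q ≤ k} := by
  refine isClosed_of_columns (fun x => (h x x).2 (.inl rfl)) fun x => ?_
  simp only [mem_ofPred_eq, h]
  exact (isClosed_eq continuous_const continuous_id).union
      ((isClosed_const.inter isClosed_setOf_isEndpoint).union isClosed_const)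

theorem isClosed_orbitClass_le_zero : IsClosed {q | orbitClass q ≤ 0} := by
  have h1 : IsClosed {q | (π q).1 = (π q).2} := by
    refine isClosed_of_columns (by simp) fun x => ?_
    simp
  convert h1.inter (isClosed_setOf_isEndpoint.preimage continuous_snd) using 1
  ext q
  simp only [orbitClass, mem_ofPred_eq, mem_inter_iff, mem_preimage]
  split_ifs <;> simp_all

theorem isClosed_orbitClass_le (k : Fin 6) : IsClosed {q | orbitClass q ≤ k} := by
  have hval : ∀ x y, orbitClass ((π).symm (x, y)) = _ := fun x y => by
    unfold orbitClass
    rw [Equiv.apply_symm_apply]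
  have key : ∀ k : Fin 6, k ≠ 0 → ∀ x y, orbitClass ((π).symm (x, y)) ≤ k ↔
      x = y ∨ (k = 2 ∧ IsEndpoint x ∨ k = 3 ∧ IsEndpoint x ∨ 4 ≤ k) ∧ IsEndpoint y ∨
        (3 ≤ k ∧ IsEndpoint x ∨ k = 5) := by
    intro k hk x y
    rw [hval]
    by_cases h1 : x = y <;> by_cases h2 : IsEndpoint x <;> by_cases h3 : IsEndpoint y <;>
      simp only [h1, h2, h3, if_true, if_false] <;> revert k <;> simp <;> decide
  rcases eq_or_ne k 0 with rfl | hk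
  · exact isClosed_orbitClass_le_zero
  · exact isClosed_orbitClass_le_of_iff (key k hk)

theorem groupHeight_top :
    groupHeight (⊤ : Subgroup (AlexandroffSquare ≃ₜ AlexandroffSquare)) = 5 :=
  groupHeight_top_eq orbitClass orbitClass_surjective orbitClass_homeomorph
    (fun _ _ => exists_homeomorph_of_orbitClass_eq) isClosed_orbitClass_le

end AlexandroffSquare

/-! ### The lexicographic square -/

/-- The coordinates on the lexicographic square. -/
def lexEquiv : LexSquare ≃ I × I := ofLex

namespace LexSquare

local notation "π" => lexEquiv

instance : OrderTopology LexSquare := ⟨rfl⟩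

theorem lt_iff {q r : LexSquare} :
    q < r ↔ (π q).1 < (π r).1 ∨ (π q).1 = (π r).1 ∧ (π q).2 < (π r).2 :=
  Prod.Lex.lt_iff

theorem le_iff {q r : LexSquare} :
    q ≤ r ↔ (π q).1 < (π r).1 ∨ (π q).1 = (π r).1 ∧ (π q).2 ≤ (π r).2 :=
  Prod.Lex.le_iff

theorem column_eq_Icc (x : I) : {q | (π q).1 = x} = Icc ((π).symm (x, 0)) ((π).symm (x, 1)) := by
  ext q
  simp only [mem_ofPred_eq, mem_Icc, le_iff, Equiv.apply_symm_apply]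
  constructor
  · rintro rfl
    exact ⟨.inr ⟨rfl, nonneg'⟩, .inr ⟨rfl, le_one'⟩⟩
  · rintro ⟨h1, h2⟩
    rcases h1 with h1 | h1 <;> rcases h2 with h2 | h2
    · exact absurd h1 h2.asymm
    exacts [h2.1, h1.1.symm, h2.1]

theorem isClosed_column (x : I) : IsClosed {q | (π q).1 = x} := by
  rw [column_eq_Icc]
  exact isClosed_Icc

theorem isEmbedding_column (x : I) : Topology.IsEmbedding fun y => (π).symm (x, y) := by
  have h1 : range (fun y => (π).symm (x, y)) = {q | (π q).1 = x} := by
    ext q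
    constructor
    · rintro ⟨y, rfl⟩
      simp
    · rintro rfl
      exact ⟨(π q).2, (π).symm_apply_apply q⟩
  have h2 : StrictMono fun y => (π).symm (x, y) := fun y z hyz => by
    simpa [lt_iff] using hyz
  have h3 : OrdConnected (range fun y => (π).symm (x, y)) := by
    rw [h1, column_eq_Icc]
    exact ordConnected_Icc
  exact h2.isEmbedding_of_ordConnected h3

/-- The points at which the columns are open. -/
def IsRegular (q : LexSquare) : Prop :=
  ((π q).2 = 0 → (π q).1 = 0) ∧ ((π q).2 = 1 → (π q).1 = 1)

/-- The regular points of an inner column form the open interval between its ends. In the outer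
columns the end of the order is included, and the interval becomes an open ray. -/
theorem isOpen_column_isRegular (x : I) : IsOpen {q | q ∈ {q | IsRegular q} ∧ (π q).1 = x} := by
  have h01 := zero_ne_one (α := I)
  have hpos : ∀ {t : I}, 0 < t ↔ t ≠ 0 := unitInterval.pos_iff_ne_zero
  have hlt : ∀ {t : I}, t < 1 ↔ t ≠ 1 := unitInterval.lt_one_iff_ne_one
  have hn0 : ∀ {t : I}, ¬ t < 0 := not_lt.2 nonneg'
  have hn1 : ∀ {t : I}, ¬ 1 < t := not_lt.2 le_one'
  by_cases hx0 : x = 0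
  · convert isOpen_Iio (a := (π).symm ((0 : I), (1 : I))) using 1
    ext q
    simp only [IsRegular, mem_ofPred_eq, mem_Iio, lt_iff, Equiv.apply_symm_apply]
    grind
  by_cases hx1 : x = 1
  · convert isOpen_Ioi (a := (π).symm ((1 : I), (0 : I))) using 1
    ext q
    simp only [IsRegular, mem_ofPred_eq, mem_Ioi, lt_iff, Equiv.apply_symm_apply]
    grind
  convert isOpen_Ioo (a := (π).symm (x, 0)) (b := (π).symm (x, 1)) using 1
  ext q
  simp only [IsRegular, mem_ofPred_eq, mem_Ioo, lt_iff, Equiv.apply_symm_apply]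
  grind

/-- The product of two order automorphisms of the interval. -/
theorem exists_homeomorph_map (f h : I ≃o I) : ∃ g : LexSquare ≃ₜ LexSquare,
    ∀ q, π (g q) = (f (π q).1, h (π q).2) := by
  let F : LexSquare ≃o LexSquare :=
    { toEquiv := (lexEquiv.trans (f.toEquiv.prodCongr h.toEquiv)).trans lexEquiv.symm
      map_rel_iff' := by
        intro q r
        simp [le_iff] }
  exact ⟨F.toHomeomorph, fun q => by simp [F, Prod.map]⟩

/-- The reversal of the order. -/
theorem exists_homeomorph_symm : ∃ g : LexSquare ≃ₜ LexSquare,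
    ∀ q, π (g q) = (σ (π q).1, σ (π q).2) := by
  let r : LexSquare → LexSquare := fun q => (π).symm (σ (π q).1, σ (π q).2)
  have hr : Function.Involutive r := fun q => by simp [r]
  have hanti : ∀ {a b}, r a < r b ↔ b < a := by
    intro a b
    simp only [r, lt_iff, Equiv.apply_symm_apply, unitInterval.symm_lt_symm, unitInterval.symm_inj]
    rw [eq_comm]
  have hcont : Continuous r := by
    refine continuous_generateFrom_iff.2 ?_
    rintro s ⟨a, rfl | rfl⟩
    · convert isOpen_Iio (a := r a) using 1
      ext q
      rw [mem_preimage, mem_Ioi, mem_Iio, ← hanti, hr]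
    · convert isOpen_Ioi (a := r a) using 1
      ext q
      rw [mem_preimage, mem_Ioi, mem_Iio, ← hanti, hr]
  exact ⟨⟨⟨r, r, hr, hr⟩, hcont, hcont⟩, fun q => (π).apply_symm_apply _⟩

/-- A neighbourhood of the bottom of a column other than the first reaches down into an earlier
column, and so contains all of the uncountably many columns in between. -/
theorem not_isLocallySeparableAt_of_snd_eq_zero {q : LexSquare} (h0 : (π q).2 = 0)
    (hx : (π q).1 ≠ 0) : ¬ IsLocallySeparableAt q := by
  rintro ⟨O, hO, hq, S, hS, hOS⟩
  obtain ⟨l, hl, hlO⟩ := exists_Ioc_subset_of_mem_nhds (hO.mem_nhds hq)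
    ⟨(π).symm (0, 0), by simp [lt_iff, unitInterval.pos_iff_ne_zero, hx]⟩
  have hlx : (π l).1 < (π q).1 := by
    rcases lt_iff.1 hl with h | ⟨-, h⟩
    · exact h
    · rw [h0] at h
      exact absurd h (not_lt.2 nonneg')
  refine not_subset_closure_of_uncountable_columns π (not_countable_Ioo_unitInterval hlx) hS ?_ hOS
  intro x hx
  obtain ⟨t, ht⟩ := exists_between (zero_lt_one (α := I))
  refine ⟨Ioo ((π).symm (x, 0)) ((π).symm (x, 1)), isOpen_Ioo, ⟨(π).symm (x, t), ?_⟩, ?_, ?_⟩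
  · simpa [lt_iff] using ht
  · intro r hr
    have hrx : (π r).1 = x := by
      have : r ∈ {q | (π q).1 = x} := column_eq_Icc x ▸ Ioo_subset_Icc_self hr
      exact this
    refine hlO ⟨lt_iff.2 (.inl (by rw [hrx]; exact hx.1)), (lt_iff.2 (.inl ?_)).le⟩
    rw [hrx]
    exact hx.2
  · intro r hr
    have : r ∈ {q | (π q).1 = x} := column_eq_Icc x ▸ Ioo_subset_Icc_self hr
    exact this

theorem isLocallySeparableAt_iff {q : LexSquare} : IsLocallySeparableAt q ↔ IsRegular q := by
  constructor
  · refine fun h => ⟨fun h0 => ?_, fun h1 => ?_⟩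
    · by_contra hx
      exact not_isLocallySeparableAt_of_snd_eq_zero h0 hx h
    · by_contra hx
      -- The reversal turns the top of a column into the bottom of another.
      obtain ⟨g, hg⟩ := exists_homeomorph_symm
      exact not_isLocallySeparableAt_of_snd_eq_zero (by simp [hg, h1]) (by simp [hg, hx]) (h.map g)
  · exact fun h => isLocallySeparableAt_of_column π (isOpen_column_isRegular _)
      (isEmbedding_column _).continuous h rfl

theorem isRegular_homeomorph_iff (g : LexSquare ≃ₜ LexSquare) (q : LexSquare) :
    IsRegular (g q) ↔ IsRegular q := by
  rw [← isLocallySeparableAt_iff, ← isLocallySeparableAt_iff, isLocallySeparableAt_map_iff]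

/-- The interior of a column is connected and regular, and its closure adds both ends. -/
theorem exists_fst_homeomorph_column (g : LexSquare ≃ₜ LexSquare) (x : I) :
    ∃ c, ∀ y, (π (g ((π).symm (x, y)))).1 = c := by
  obtain ⟨c, hc⟩ := exists_column_of_isPreconnected π isOpen_column_isRegular isClosed_column
    (isPreconnected_Ioo (a := (0 : I)) (b := 1)) (nonempty_Ioo.2 zero_lt_one)
    (f := fun y => g ((π).symm (x, y))) (g.continuous.comp (isEmbedding_column x).continuous) (by
      intro y hy
      rw [mem_ofPred_eq, isRegular_homeomorph_iff]
      refine ⟨fun h => absurd ?_ hy.1.ne', fun h => absurd ?_ hy.2.ne⟩ <;> simpa using h)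
  refine ⟨c, fun y => hc y ?_⟩
  rw [closure_Ioo zero_ne_one]
  exact ⟨nonneg', le_one'⟩

theorem isEndpoint_snd_iff (g : LexSquare ≃ₜ LexSquare) (q : LexSquare) :
    IsEndpoint (π (g q)).2 ↔ IsEndpoint (π q).2 :=
  isEndpoint_snd_homeomorph_iff π isEmbedding_column exists_fst_homeomorph_column g q

/-- For an endpoint `x`, the point `(x, x)` is an end of the order: it is regular and an end of its
column. Its image has both properties, which forces it to lie in an outer column. -/
theorem isEndpoint_fst_of_isEndpoint (g : LexSquare ≃ₜ LexSquare) {q : LexSquare}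
    (h : IsEndpoint (π q).1) : IsEndpoint (π (g q)).1 := by
  obtain ⟨⟨x, y⟩, rfl⟩ := (π).symm.surjective q
  replace h : IsEndpoint x := by simpa using h
  obtain ⟨c, hc⟩ := exists_fst_homeomorph_column g x
  have h1 : IsRegular (g ((π).symm (x, x))) := (isRegular_homeomorph_iff g _).2 <| by
    simp [IsRegular]
  have h2 : IsEndpoint (π (g ((π).symm (x, x)))).2 := (isEndpoint_snd_iff g _).2 (by simpa using h)
  rw [hc, ← hc x]
  exact h2.imp h1.1 h1.2

theorem isEndpoint_fst_iff (g : LexSquare ≃ₜ LexSquare) (q : LexSquare) :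
    IsEndpoint (π (g q)).1 ↔ IsEndpoint (π q).1 :=
  ⟨fun h => by simpa using isEndpoint_fst_of_isEndpoint g.symm h, isEndpoint_fst_of_isEndpoint g⟩

open Classical in
/-- The number of the orbit of a point: the two ends of the order, the other endpoints of the outer
columns, the rest of the outer columns, the endpoints of the inner columns, and the rest. -/
noncomputable def orbitClass (q : LexSquare) : Fin 5 :=
  if IsEndpoint (π q).1 then if IsEndpoint (π q).2 then if IsRegular q then 0 else 1 else 2
  else if IsEndpoint (π q).2 then 3 else 4

theorem orbitClass_homeomorph (g : LexSquare ≃ₜ LexSquare) (q : LexSquare) :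
    orbitClass (g q) = orbitClass q := by
  unfold orbitClass
  rw [isRegular_homeomorph_iff, isEndpoint_fst_iff, isEndpoint_snd_iff]

theorem exists_homeomorph_of_eq_zero_iff {q r : LexSquare}
    (h1 : (π q).1 = 0 ↔ (π r).1 = 0) (h2 : (π q).1 = 1 ↔ (π r).1 = 1)
    (h3 : (π q).2 = 0 ↔ (π r).2 = 0) (h4 : (π q).2 = 1 ↔ (π r).2 = 1) :
    ∃ g : LexSquare ≃ₜ LexSquare, g q = r := by
  obtain ⟨f, hf⟩ := exists_orderIso_apply_eq h1 h2
  obtain ⟨h, hh⟩ := exists_orderIso_apply_eq h3 h4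
  obtain ⟨g, hg⟩ := exists_homeomorph_map f h
  refine ⟨g, (π).injective ?_⟩
  rw [hg, hf, hh]

/-- Points of the same class have the same coordinates equal to 0 or 1, possibly after the order is
reversed; then the two coordinates can be moved independently. -/
theorem exists_homeomorph_of_orbitClass_eq {q r : LexSquare} (h : orbitClass q = orbitClass r) :
    ∃ g : LexSquare ≃ₜ LexSquare, g q = r := by
  have h01 := zero_ne_one (α := I)
  have h1 : IsEndpoint (π q).1 ↔ IsEndpoint (π r).1 := by
    unfold orbitClass at h; split_ifs at h <;> simp_all
  have h2 : IsEndpoint (π q).2 ↔ IsEndpoint (π r).2 := by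
    unfold orbitClass at h; split_ifs at h <;> simp_all
  have h3 : IsEndpoint (π q).1 → IsEndpoint (π q).2 → (IsRegular q ↔ IsRegular r) := by
    unfold orbitClass at h; split_ifs at h <;> simp_all
  clear h
  unfold IsRegular at h3
  unfold IsEndpoint at h1 h2 h3
  by_cases hsame : ((π q).1 = 0 ↔ (π r).1 = 0) ∧ ((π q).1 = 1 ↔ (π r).1 = 1) ∧
      ((π q).2 = 0 ↔ (π r).2 = 0) ∧ ((π q).2 = 1 ↔ (π r).2 = 1)
  · exact exists_homeomorph_of_eq_zero_iff hsame.1 hsame.2.1 hsame.2.2.1 hsame.2.2.2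
  · obtain ⟨s, hs⟩ := exists_homeomorph_symm
    obtain ⟨g, hg⟩ := exists_homeomorph_of_eq_zero_iff (q := s q) (r := r)
      (by rw [hs, unitInterval.symm_eq_zero]; grind)
      (by rw [hs, unitInterval.symm_eq_one]; grind)
      (by rw [hs, unitInterval.symm_eq_zero]; grind)
      (by rw [hs, unitInterval.symm_eq_one]; grind)
    exact ⟨s.trans g, hg⟩

theorem orbitClass_surjective : Function.Surjective orbitClass := by
  obtain ⟨t, ht⟩ := exists_not_isEndpoint
  have e0 := isEndpoint_zero
  have e1 := isEndpoint_one
  have h : ∀ x y, orbitClass ((π).symm (x, y)) = _ := fun x y => by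
    unfold orbitClass IsRegular
    rw [Equiv.apply_symm_apply]
  intro k
  fin_cases k
  · exact ⟨(π).symm (0, 0), by simp [h, e0]⟩
  · exact ⟨(π).symm (0, 1), by simp [h, e0, e1]⟩
  · exact ⟨(π).symm (0, t), by simp [h, e0, ht]⟩
  · exact ⟨(π).symm (t, 0), by simp [h, e0, ht]⟩
  · exact ⟨(π).symm (t, t), by simp [h, ht]⟩

theorem isClosed_orbitClass_le (k : Fin 5) : IsClosed {q | orbitClass q ≤ k} := by
  have hE : {q | IsEndpoint (π q).1 ∧ IsEndpoint (π q).2}.Finite := by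
    have h1 : ({t | IsEndpoint t} : Set I).Finite := toFinite ({0, 1} : Set I)
    exact (h1.prod h1).preimage (f := π) (π).injective.injOn
  fin_cases k
  · refine (hE.subset fun q hq => ?_).isClosed
    unfold orbitClass at hq
    simp only [mem_ofPred_eq] at hq ⊢
    split_ifs at hq <;> simp_all
  · refine (hE.subset fun q hq => ?_).isClosed
    unfold orbitClass at hq
    simp only [mem_ofPred_eq] at hq ⊢
    split_ifs at hq <;> simp_all
  · convert (isClosed_column 0).union (isClosed_column 1) using 1
    ext q
    change _ ↔ IsEndpoint (π q).1
    simp only [mem_ofPred_eq, orbitClass]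
    split_ifs <;> simp_all
  -- The complement, class 4, is the union of the interiors of the inner columns.
  · rw [← isOpen_compl_iff]
    convert isOpen_iUnion (fun x : Ioo (0 : I) 1 =>
      isOpen_Ioo (a := (π).symm (x.1, 0)) (b := (π).symm (x.1, 1))) using 1
    ext q
    have h1 : q ∈ {q | orbitClass q ≤ 3}ᶜ ↔
        (π q).1 ∈ Ioo (0 : I) 1 ∧ (π q).2 ∈ Ioo (0 : I) 1 := by
      rw [← not_isEndpoint_iff, ← not_isEndpoint_iff, mem_compl_iff, mem_ofPred_eq, orbitClass]
      split_ifs <;> simp_all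
    refine h1.trans ?_
    simp only [mem_iUnion, mem_Ioo, lt_iff, Equiv.apply_symm_apply]
    constructor
    · rintro ⟨hx, hy⟩
      exact ⟨⟨_, hx⟩, .inr ⟨rfl, hy.1⟩, .inr ⟨rfl, hy.2⟩⟩
    · rintro ⟨⟨x, hx⟩, h2, h3⟩
      rcases h2 with h2 | ⟨rfl, h2⟩
      · rcases h3 with h3 | ⟨h3, -⟩
        · exact absurd h2 h3.asymm
        · exact absurd h3 h2.ne'
      · exact ⟨hx, h2, h3.resolve_left (lt_irrefl _) |>.2⟩
  · convert isClosed_univ using 1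
    exact eq_univ_of_forall fun q => Fin.le_last _

theorem groupHeight_top : groupHeight (⊤ : Subgroup (LexSquare ≃ₜ LexSquare)) = 4 :=
  groupHeight_top_eq orbitClass orbitClass_surjective orbitClass_homeomorph
    (fun _ _ => exists_homeomorph_of_orbitClass_eq) isClosed_orbitClass_le

end LexSquare

/-! ### The Euclidean square -/

/-- Every continuous nonvanishing complex function on the complement of `p` has a continuous
logarithm. -/
def HasLogarithmsOff {X : Type*} [TopologicalSpace X] (p : X) : Prop :=
  ∀ f : C({q // q ≠ p}, {z : ℂ // z ≠ 0}), ∃ L : C({q // q ≠ p}, ℂ), ∀ q, Complex.exp (L q) = f q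

theorem HasLogarithmsOff.map {X Y : Type*} [TopologicalSpace X] [TopologicalSpace Y] {p : X}
    (h : HasLogarithmsOff p) (g : X ≃ₜ Y) : HasLogarithmsOff (g p) := by
  intro f
  let e : {q // q ≠ p} ≃ₜ {q // q ≠ g p} := g.subtype fun q => by simp
  obtain ⟨L, hL⟩ := h (f.comp e)
  refine ⟨L.comp e.symm, fun q => ?_⟩
  have := hL (e.symm q)
  simpa using this

namespace EuclideanSquare

/-- The points of the boundary of the square. -/
def IsBoundary (p : EuclideanSquare) : Prop := IsEndpoint p.1 ∨ IsEndpoint p.2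

/-- The homothety with ratio `t` and centre the midpoint of the interval. -/
noncomputable def shrink (t x : I) : I :=
  ⟨t * x + (1 - t) * 2⁻¹, by
    have := t.2.1; have := t.2.2; have := x.2.1; have := x.2.2
    exact add_nonneg (by positivity) (mul_nonneg (by linarith) (by norm_num)), by
    have := t.2.1; have := t.2.2; have := x.2.1; have := x.2.2
    nlinarith⟩

theorem continuous_shrink : Continuous fun q : I × I => shrink q.1 q.2 := by
  unfold shrink
  fun_prop

theorem shrink_zero (x : I) : shrink 0 x = shrink 0 0 := by simp [shrink]

theorem shrink_one (x : I) : shrink 1 x = x := by simp [shrink]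

theorem not_isEndpoint_shrink {t x : I} (ht : t ≠ 1) : ¬ IsEndpoint (shrink t x) := by
  have ht1 : (t : ℝ) < 1 := unitInterval.lt_one_iff_ne_one.2 ht
  have h0 := mul_nonneg t.2.1 x.2.1
  have h1 := mul_nonneg t.2.1 (sub_nonneg.2 x.2.2)
  rintro (h | h) <;> have h' := congrArg Subtype.val h <;> simp [shrink] at h' <;> nlinarith

/-- Shrinking towards the centre never meets a boundary point `p` unless it starts there, so the
complement of `p` is contractible. The resulting homotopy from a constant to `f` lifts through the
exponential covering. -/
theorem hasLogarithmsOff_of_isBoundary {p : EuclideanSquare} (hp : IsBoundary p) :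
    HasLogarithmsOff p := by
  intro f
  have hne : ∀ (t : I) (q : {q // q ≠ p}), (shrink t q.1.1, shrink t q.1.2) ≠ p := by
    intro t q h
    rcases eq_or_ne t 1 with rfl | ht
    · simp only [shrink_one] at h
      exact q.2 h
    · rcases hp with hp | hp
      · exact not_isEndpoint_shrink ht (x := q.1.1) (by rwa [← h] at hp)
      · exact not_isEndpoint_shrink ht (x := q.1.2) (by rwa [← h] at hp)
  let H : C(I × {q // q ≠ p}, {q // q ≠ p}) :=
    ⟨fun a => ⟨(shrink a.1 a.2.1.1, shrink a.1 a.2.1.2), hne a.1 a.2⟩, by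
      refine Continuous.subtype_mk (Continuous.prodMk ?_ ?_) _
      · exact continuous_shrink.comp (f := fun a : I × {q // q ≠ p} => (a.1, a.2.1.1))
          (by fun_prop)
      · exact continuous_shrink.comp (f := fun a : I × {q // q ≠ p} => (a.1, a.2.1.2))
          (by fun_prop)⟩
  rcases isEmpty_or_nonempty {q // q ≠ p} with hE | ⟨⟨a⟩⟩
  · exact ⟨0, fun q => hE.elim q⟩
  have hconst : ∀ q, H (0, q) = H (0, a) := fun q => Subtype.ext <| Prod.ext
    ((shrink_zero _).trans (shrink_zero _).symm) ((shrink_zero _).trans (shrink_zero _).symm)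
  let E := Complex.isCoveringMap_exp.liftHomotopy (f.comp H)
    (.const _ (Complex.log (f (H (0, a))))) fun q => by
      refine Subtype.ext ?_
      simp only [ContinuousMap.comp_apply, ContinuousMap.const_apply, hconst q]
      exact (Complex.exp_log (f (H (0, a))).2).symm
  refine ⟨E.comp ⟨fun q => (1, q), by fun_prop⟩, fun q => ?_⟩
  have hE : (fun z : ℂ => (⟨_, z.exp_ne_zero⟩ : {z : ℂ // z ≠ 0})) ∘ E = f.comp H :=
    Complex.isCoveringMap_exp.liftHomotopy_lifts _ _ _
  have h1 := congrFun hE (1, q)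
  have h2 : H (1, q) = q := Subtype.ext (Prod.ext (shrink_one _) (shrink_one _))
  have h3 := congrArg Subtype.val h1
  simp only [ContinuousMap.comp_apply, h2] at h3
  exact h3

/-- Around an interior point `p`, a logarithm of `q - p` would grow by `2πi` along a small circle
and yet return to its initial value. -/
theorem isBoundary_of_hasLogarithmsOff {p : EuclideanSquare} (hp : HasLogarithmsOff p) :
    IsBoundary p := by
  by_contra hb
  rw [IsBoundary, not_or, not_isEndpoint_iff, not_isEndpoint_iff] at hb
  obtain ⟨⟨⟨x, hx⟩, ⟨y, hy⟩⟩, rfl⟩ : ∃ q : I × I, q = p := ⟨p, rfl⟩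
  obtain ⟨⟨hx0, hx1⟩, ⟨hy0, hy1⟩⟩ := hb
  replace hx0 : 0 < x := hx0
  replace hx1 : x < 1 := hx1
  replace hy0 : 0 < y := hy0
  replace hy1 : y < 1 := hy1
  obtain ⟨r, hr0, hr⟩ : ∃ r, 0 < r ∧ r < min (min x (1 - x)) (min y (1 - y)) :=
    exists_between (by simp only [lt_min_iff]; exact ⟨⟨hx0, by linarith⟩, hy0, by linarith⟩)
  simp only [lt_min_iff] at hr
  obtain ⟨⟨hr1, hr2⟩, hr3, hr4⟩ := hr
  let f : C({q : EuclideanSquare // q ≠ (⟨x, hx⟩, ⟨y, hy⟩)}, {z : ℂ // z ≠ 0}) :=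
    ⟨fun q => ⟨((q.1.1 - x : ℝ) : ℂ) + ((q.1.2 - y : ℝ) : ℂ) * Complex.I, fun h => q.2 <| by
      have h1 := congrArg Complex.re h
      have h2 := congrArg Complex.im h
      simp at h1 h2
      exact Prod.ext (Subtype.ext (by simp; linarith)) (Subtype.ext (by simp; linarith))⟩,
      by fun_prop⟩
  obtain ⟨L, hL⟩ := hp f
  have hbound : ∀ c : ℝ, |c| ≤ 1 → |r * c| ≤ r := fun c hc => by
    rw [abs_mul, abs_of_pos hr0]
    exact mul_le_of_le_one_right hr0.le hc
  have hc := fun θ => abs_le.1 (hbound _ (Real.abs_cos_le_one θ))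
  have hs := fun θ => abs_le.1 (hbound _ (Real.abs_sin_le_one θ))
  let γ : ℝ → {q : EuclideanSquare // q ≠ (⟨x, hx⟩, ⟨y, hy⟩)} := fun θ =>
    ⟨(⟨x + r * Real.cos θ, by linarith [hc θ], by linarith [hc θ]⟩,
      ⟨y + r * Real.sin θ, by linarith [hs θ], by linarith [hs θ]⟩), fun h => by
      have h1 := congrArg (fun q : EuclideanSquare => (q.1 : ℝ)) h
      have h2 := congrArg (fun q : EuclideanSquare => (q.2 : ℝ)) h
      simp [hr0.ne'] at h1 h2
      have := Real.sin_sq_add_cos_sq θ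
      simp [h1, h2] at this⟩
  have hγ : Continuous γ := by
    refine Continuous.subtype_mk (Continuous.prodMk ?_ ?_) _ <;>
      exact Continuous.subtype_mk (by fun_prop) _
  have hfγ : ∀ θ, (f (γ θ) : ℂ) = r * Complex.exp (θ * Complex.I) := by
    intro θ
    rw [Complex.exp_mul_I]
    simp [f, γ]
    ring
  -- Both sides lift `θ ↦ f (γ θ)` through the exponential and agree at 0.
  have hlift : (fun θ : ℝ => L (γ θ)) = fun θ : ℝ => L (γ 0) + θ * Complex.I := by
    refine Complex.isCoveringMap_exp.eq_of_comp_eq (by fun_prop) (by fun_prop) ?_ 0 (by simp)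
    funext θ
    refine Subtype.ext ?_
    simp only [Function.comp_apply]
    rw [Complex.exp_add, hL, hL, hfγ, hfγ]
    simp
  have h1 := congrFun hlift (2 * Real.pi)
  have h2 : γ (2 * Real.pi) = γ 0 := Subtype.ext (by simp [γ])
  simp [h2, Real.pi_ne_zero] at h1

theorem isBoundary_homeomorph_iff (g : EuclideanSquare ≃ₜ EuclideanSquare) (p : EuclideanSquare) :
    IsBoundary (g p) ↔ IsBoundary p :=
  ⟨fun h => isBoundary_of_hasLogarithmsOff
    (by simpa using (hasLogarithmsOff_of_isBoundary h).map g.symm),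
    fun h => isBoundary_of_hasLogarithmsOff ((hasLogarithmsOff_of_isBoundary h).map g)⟩

/-- The unit square in the complex plane. -/
def complexSquare : Set ℂ := Icc 0 1 ×ℂ Icc 0 1

/-- The square as a subset of the complex plane. -/
noncomputable def homeomorphComplexSquare : EuclideanSquare ≃ₜ complexSquare where
  toFun p := ⟨⟨p.1, p.2⟩, p.1.2, p.2.2⟩
  invFun z := (⟨z.1.re, z.2.1⟩, ⟨z.1.im, z.2.2⟩)
  left_inv _ := rfl
  right_inv _ := rfl
  continuous_toFun := by
    refine Continuous.subtype_mk ?_ _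
    have h : (fun p : EuclideanSquare => (⟨p.1, p.2⟩ : ℂ)) =
        fun p => ((p.1 : ℝ) : ℂ) + ((p.2 : ℝ) : ℂ) * Complex.I := by
      funext p
      exact Complex.mk_eq_add_mul_I _ _
    rw [h]
    fun_prop
  continuous_invFun := by
    refine Continuous.prodMk ?_ ?_ <;> refine Continuous.subtype_mk ?_ _
    · exact Complex.continuous_re.comp continuous_subtype_val
    · exact Complex.continuous_im.comp continuous_subtype_val

theorem isClosed_complexSquare : IsClosed complexSquare := isClosed_Icc.reProdIm isClosed_Icc

theorem mem_frontier_complexSquare {p : EuclideanSquare} (hp : IsBoundary p) :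
    (homeomorphComplexSquare p : ℂ) ∈ frontier complexSquare := by
  have hE : ∀ {t : I}, IsEndpoint t → (t : ℝ) ∈ ({0, 1} : Set ℝ) := by
    rintro t (rfl | rfl) <;> simp
  have h : frontier complexSquare = Icc 0 1 ×ℂ {0, 1} ∪ {0, 1} ×ℂ Icc 0 1 := by
    rw [complexSquare, Complex.frontier_reProdIm, frontier_Icc zero_le_one, closure_Icc]
  rw [h]
  exact hp.symm.imp (fun h => ⟨p.1.2, hE h⟩) fun h => ⟨hE h, p.2.2⟩

theorem exists_homeomorph_complexSquare_ball : ∃ e : ℂ ≃ₜ ℂ,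
    e '' complexSquare = Metric.closedBall 0 1 ∧
      e '' frontier complexSquare = Metric.sphere 0 1 := by
  have hconv : Convex ℝ complexSquare :=
    ((convex_Icc (0 : ℝ) 1).linear_preimage Complex.reLm).inter
      ((convex_Icc (0 : ℝ) 1).linear_preimage Complex.imLm)
  have hint : (interior complexSquare).Nonempty := by
    rw [complexSquare, Complex.interior_reProdIm, interior_Icc]
    exact ⟨⟨2⁻¹, 2⁻¹⟩, by constructor <;> norm_num⟩
  have hbdd : Bornology.IsBounded complexSquare :=
    (Metric.isBounded_Icc 0 1).reProdIm (Metric.isBounded_Icc 0 1)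
  obtain ⟨e, -, h1, h2⟩ :=
    exists_homeomorph_image_interior_closure_frontier_eq_unitBall hconv hint hbdd
  exact ⟨e, by rwa [isClosed_complexSquare.closure_eq] at h1, h2⟩

theorem exists_homeomorph_of_isBoundary {p q : EuclideanSquare} (hp : IsBoundary p)
    (hq : IsBoundary q) : ∃ g : EuclideanSquare ≃ₜ EuclideanSquare, g p = q := by
  obtain ⟨e, h1, h2⟩ := exists_homeomorph_complexSquare_ball
  have hnorm : ∀ {p}, IsBoundary p → ‖e (homeomorphComplexSquare p)‖ = 1 := fun {p} hp => by
    have := h2 ▸ mem_image_of_mem e (mem_frontier_complexSquare hp)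
    simpa using this
  have hmem : ∀ z, z ∈ complexSquare ↔ ‖e z‖ ≤ 1 := fun z => by
    rw [← e.injective.mem_set_image, h1, mem_closedBall_zero_iff]
  have hp0 : e (homeomorphComplexSquare p) ≠ 0 := norm_ne_zero_iff.1 (by rw [hnorm hp]; simp)
  set w := e (homeomorphComplexSquare q) / e (homeomorphComplexSquare p) with hw
  have hw1 : ‖w‖ = 1 := by rw [hw, norm_div, hnorm hp, hnorm hq, div_one]
  -- The rotation by `w` of the disc, transported to the square by `e`.
  let R : ℂ ≃ₜ ℂ := (e.trans (Homeomorph.mulLeft₀ w (norm_ne_zero_iff.1 (by simp [hw1])))).trans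
    e.symm
  have hR : ∀ z, R z = e.symm (w * e z) := fun z => rfl
  let R' : complexSquare ≃ₜ complexSquare := R.subtype fun z => by
    rw [hmem, hmem, hR, e.apply_symm_apply, norm_mul, hw1, one_mul]
  refine ⟨(homeomorphComplexSquare.trans R').trans homeomorphComplexSquare.symm, ?_⟩
  have h3 : R' (homeomorphComplexSquare p) = homeomorphComplexSquare q := by
    refine Subtype.ext ?_
    change R _ = _
    rw [hR, hw, div_mul_cancel₀ _ hp0, e.symm_apply_apply]
  simp [h3]

theorem exists_homeomorph_of_not_isBoundary {p q : EuclideanSquare} (hp : ¬ IsBoundary p)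
    (hq : ¬ IsBoundary q) : ∃ g : EuclideanSquare ≃ₜ EuclideanSquare, g p = q := by
  rw [IsBoundary, not_or] at hp hq
  obtain ⟨f, hf⟩ := exists_homeomorph_apply_eq (iff_of_false hp.1 hq.1)
  obtain ⟨h, hh⟩ := exists_homeomorph_apply_eq (iff_of_false hp.2 hq.2)
  exact ⟨f.prodCongr h, Prod.ext hf hh⟩

theorem groupHeight_top : groupHeight (⊤ : Subgroup (EuclideanSquare ≃ₜ EuclideanSquare)) = 1 := by
  classical
  let c : EuclideanSquare → Fin 2 := fun p => if IsBoundary p then 0 else 1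
  have hcb : ∀ p, c p = 0 ↔ IsBoundary p := fun p => by simp [c]
  refine groupHeight_top_eq c (fun k => ?_) (fun g p => ?_) (fun p q h => ?_) fun k => ?_
  · obtain ⟨t, ht⟩ := exists_not_isEndpoint
    fin_cases k
    · exact ⟨(0, 0), (hcb _).2 (.inl isEndpoint_zero)⟩
    · exact ⟨(t, t), if_neg (by simp [IsBoundary, ht])⟩
  · simp only [c, isBoundary_homeomorph_iff]
  · by_cases hp : IsBoundary p
    · exact exists_homeomorph_of_isBoundary hp ((hcb q).1 (h ▸ (hcb p).2 hp))
    · exact exists_homeomorph_of_not_isBoundary hp fun hq => hp ((hcb p).1 (h ▸ (hcb q).2 hq))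
  · fin_cases k
    · convert (isClosed_setOf_isEndpoint.preimage continuous_fst).union
        (isClosed_setOf_isEndpoint.preimage continuous_snd) using 1
      ext p
      change c p ≤ 0 ↔ IsBoundary p
      rw [Fin.le_zero_iff, hcb]
    · convert isClosed_univ using 1
      exact eq_univ_of_forall fun p => Fin.le_last _

end EuclideanSquare

theorem mainTheorem2 :
    (groupHeight (⊤ : Subgroup (AlexandroffSquare ≃ₜ AlexandroffSquare)) = 5 ∧
      groupHeight (⊤ : Subgroup (LexSquare ≃ₜ LexSquare)) = 4 ∧
      groupHeight (⊤ : Subgroup (EuclideanSquare ≃ₜ EuclideanSquare)) = 1) ∧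
    (IsLeast (possibleHeights AlexandroffSquare) 5 ∧
      IsLeast (possibleHeights LexSquare) 4 ∧
      IsLeast (possibleHeights EuclideanSquare) 1) := by
  refine ⟨⟨AlexandroffSquare.groupHeight_top, LexSquare.groupHeight_top,
    EuclideanSquare.groupHeight_top⟩, ?_, ?_, ?_⟩
  · rw [← AlexandroffSquare.groupHeight_top]
    exact isLeast_possibleHeights_groupHeight_top _
  · rw [← LexSquare.groupHeight_top]
    exact isLeast_possibleHeights_groupHeight_top _
  · rw [← EuclideanSquare.groupHeight_top]
    exact isLeast_possibleHeights_groupHeight_top _
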